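/- Let $d\ge 1$ be an integer and $[a,b]\subset\mathbb{R}$ a compact interval. Equip $\mathbb{R}^{d\times d}$ with the operator norm $|||\cdot|||$ induced by the Euclidean norm. For an interval $I$ and $f:I\to\mathbb{R}^{d\times d}$ let $W_I(f)=\sup\sum_{i=1}^N|||f(x_i)-f(x_{i-1})|||$, the supremum being over all finite sequences $x_0<x_1<\dots<x_N$ in $I$; $f$ has bounded variation if $W_I(f)<\infty$, and we put $\|f\|_{BV(I)}=W_I(f)+|||f(y_0)|||$ with $y_0\in I$ arbitrary but fixed (different $y_0$ give equivalent norms). If $f$ has bounded variation on $I$, let $\nu_f$ be the matrix-valued Borel measure on $I$ with $\nu_f((u,v))=f(v^-)-f(u^+)$ and $\nu_f(\{u\})=f(u^+)-f(u^-)$ for $u<v$ in $I$, where $f(u^-)$ (resp. $f(u^+)$) is read as $f(u)$ if $u$ is the left (resp. right) endpoint of $I$. For an interval $J\subset I$, $\int_J df(\tau)\,g(\tau)$ denotes integration of the matrix-valued function $g$ against $\nu_{f|_J}$, the differential standing on the left of the matrix product. A Stieltjes–Volterra kernel of type $B^\infty$ on $[a,b]\times[a,b]$ is a Borel measurable function $\kappa:[a,b]\times[a,b]\to\mathbb{R}^{d\times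 d}$ such that: $\kappa(t,\tau)=0$ for $\tau\ge t$; every partial map $\kappa(t,\cdot)$ is left-continuous and of bounded variation on $[a,b]$; $\sup_{t\in[a,b]}\|\kappa(t,\cdot)\|_{BV([a,b])}<\infty$; and for every $\varepsilon>0$ there is $\eta>0$ such that $W_{[\tau,t)}(\kappa(t,\cdot))<\varepsilon$ for all $t,\tau\in[a,b]$ with $0<t-\tau<\eta$. Let $\kappa$ be a Stieltjes–Volterra kernel of type $B^\infty$ on $[a,b]\times[a,b]$. Then $\kappa$ has a unique resolvent, that is, there is exactly one Stieltjes–Volterra kernel $\rho$ of type $B^\infty$ on $[a,b]\times[a,b]$ such that $$\rho(t,\beta)=-\kappa(t,\beta)+\int_{[\beta,t)}d\kappa(t,\tau)\,\rho(\tau,\beta)\qquad\text{for all } t,\beta\in[a,b],$$ where $d\kappa(t,\tau)$ is the differential with respect to $\tau$ (and the integral is $0$ if $\beta\ge t$). -/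

import Mathlib

open Set MeasureTheory
open scoped ENNReal NNReal
open scoped Matrix.Norms.L2Operator

/-- Closed intervals of an interval `J` are compact: needed to speak about the Lebesgue-Stieltjes
measure of a function defined on `J`. -/
instance compactIccSpaceOfOrdConnected {α : Type*} [Preorder α] [TopologicalSpace α]
    [CompactIccSpace α] (J : Set α) [J.OrdConnected] : CompactIccSpace J where
  isCompact_Icc := by
    intro x y
    rw [Subtype.isCompact_iff]
    have h : ((↑) : J → α) '' Icc x y = Icc (x : α) (y : α) := by
      ext z
      constructor
      · rintro ⟨w, hw, rfl⟩
        exact hw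
      · intro hz
        exact ⟨⟨z, Set.OrdConnected.out ‹_› x.2 y.2 hz⟩, hz, rfl⟩
    rw [h]
    exact isCompact_Icc

/-- Real `d × d` matrices. They carry the operator norm induced by the Euclidean norm. -/
abbrev RealMat (d : ℕ) : Type := Matrix (Fin d) (Fin d) ℝ

/-- The norm of `BV([a,b])` with base point `y₀`: total variation on `[a,b]` plus the norm of the
value at `y₀` (it is `∞` iff the total variation is infinite). -/
noncomputable def bvNorm {d : ℕ} {a b : ℝ} (y₀ : Icc a b) (f : Icc a b → RealMat d) : ℝ≥0∞ :=
  eVariationOn f univ + ‖f y₀‖ₑ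

/-- Stieltjes-Volterra kernels of type `B^∞` on `[a,b] × [a,b]`. -/
structure IsStieltjesVolterraKernel {d : ℕ} {a b : ℝ} (κ : Icc a b → Icc a b → RealMat d) :
    Prop where
  /-- Every entry of `κ` is Borel measurable as a function of both variables. -/
  measurable : ∀ i j, Measurable fun p : Icc a b × Icc a b => κ p.1 p.2 i j
  /-- `κ(t,τ) = 0` for `τ ≥ t`. -/
  eq_zero : ∀ t τ, t ≤ τ → κ t τ = 0
  /-- Every partial map `κ(t,·)` has bounded variation. -/
  boundedVariation : ∀ t, BoundedVariationOn (κ t) univ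
  /-- Every partial map `κ(t,·)` is left continuous. -/
  leftContinuous : ∀ t τ, ContinuousWithinAt (κ t) (Iic τ) τ
  /-- The `BV` norms of the partial maps are uniformly bounded, for every choice of the
  base point (all these choices give equivalent norms). -/
  bounded : ∀ y₀, ∃ C : ℝ≥0, ∀ t, bvNorm y₀ (κ t) ≤ C
  /-- The variation of `κ(t,·)` on `[τ,t)` tends to `0` as `τ → t⁻`, uniformly in `t`. -/
  variation_diagonal : ∀ ε : ℝ, 0 < ε → ∃ η : ℝ, 0 < η ∧ ∀ t τ : Icc a b,
    0 < (t : ℝ) - τ → (t : ℝ) - τ < η → eVariationOn (κ t) (Ico τ t) < ENNReal.ofReal ε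

open Classical in
/-- The Lebesgue-Stieltjes integral `∫_J df(τ) g(τ)` over an interval `J ⊆ [a,b]`, with the
matrix-valued differential on the left of the matrix product
(`(ContinuousLinearMap.mul ℝ _).flip x y = y * x`). The integration is against the measure `ν` of
the restriction of `f` to `J`, which is `BoundedVariationOn.vectorMeasure`: for `u, v ∈ J` it gives
mass `f(v⁻) - f(u⁺)` to `(u,v)`, and mass `f(u⁺) - f(u⁻)` to `{u}`, where `f(u⁻)` is read as `f(u)`
if `u` is the left endpoint of `J`, and `f(u⁺)` as `f(u)` if `u` is the right endpoint of `J`.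
If `f` has unbounded variation on `J`, the value is `0`. -/
noncomputable def stieltjesIntegral {d : ℕ} {a b : ℝ} (J : Set (Icc a b)) [J.OrdConnected]
    (f g : Icc a b → RealMat d) : RealMat d :=
  if hf : BoundedVariationOn (fun x : J => f x) univ then
    hf.vectorMeasure.integral (fun x : J => g x) (ContinuousLinearMap.mul ℝ (RealMat d)).flip
  else 0

/-- `ρ` is a resolvent of `κ`: a Stieltjes-Volterra kernel of type `B^∞` such that
`ρ(t,β) = -κ(t,β) + ∫_{[β,t)} dκ(t,τ) ρ(τ,β)` for all `t, β ∈ [a,b]`. -/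
structure IsResolvent {d : ℕ} {a b : ℝ} (κ ρ : Icc a b → Icc a b → RealMat d) : Prop where
  isKernel : IsStieltjesVolterraKernel ρ
  equation : ∀ t β, ρ t β = -κ t β + stieltjesIntegral (Ico β t) (κ t) (fun τ => ρ τ β)

/-! Left continuity and `κ t t = 0` make the measure `dκ(t,·)` on `[a,b]` give mass `-κ t u` to
`[u,b]`; hence it does not charge `[t,b]`. As `ρ(τ,β) = 0` for `τ ≤ β`, the integral over `[β,t)`
may be taken over all of `[a,b]`, and the resolvent equation becomes `ρ = -κ + Kρ` with the linear
operator `(Kg)(t,β) = ∫ dκ(t,τ) g(τ,β)`.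

An exponential weight `w(t) = exp(r(t-a))` turns `K` into a contraction: near the diagonal `dκ(t,·)`
has small total variation, uniformly in `t`, and away from it `w(τ)/w(t)` is small once `r` is
large. This gives `∫ w d|dκ(t,·)| ≤ w(t)/2` (`exists_weight`). Since the variation of `(Kg)(t,·)` is
at most the integral of the variations of `g(τ,·)`, `K` halves the constant in `Var g(t,·) ≤ M w(t)`
(`IsWeightedKernel.integralOp`).

The Neumann series `∑ Kⁿ(-κ)` therefore converges to a solution; its uniform smallness of variation
at the diagonal is read off from the equation itself. The difference of two resolvents is a fixed
point of `K`, so repeated halving forces it to vanish. -/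

open Filter Topology

/-! ### Total variation of Lebesgue-Stieltjes vector measures -/

section VectorMeasureOnLinearOrder

variable {α : Type*} [LinearOrder α] [TopologicalSpace α] [OrderTopology α]
  [SecondCountableTopology α] [MeasurableSpace α] [BorelSpace α]
  {E : Type*} [NormedAddCommGroup E]

/-- Two vector measures on a linear order with a least element agree if they agree on all the
half-lines `[u, ∞)`. -/
theorem MeasureTheory.VectorMeasure.ext_of_Ici {μ ν : VectorMeasure α E} {x₀ : α} (hx₀ : IsBot x₀)
    (h : ∀ u, μ (Ici u) = ν (Ici u)) : μ = ν := by
  refine VectorMeasure.ext_of_generateFrom (range Ici) ?_ ?_ isPiSystem_Ici ?_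
  · rintro _ ⟨u, rfl⟩
    exact h u
  · rw [‹BorelSpace α›.measurable_eq, borel_eq_generateFrom_Ici]
  · have : (univ : Set α) = Ici x₀ := (eq_univ_of_forall fun x => hx₀ x).symm
    rw [this, h]

/-- Two vector measures on a linear order agree if they agree on all the half-lines `(-∞, u]`. -/
theorem MeasureTheory.VectorMeasure.ext_of_Iic {μ ν : VectorMeasure α E}
    (h : ∀ u, μ (Iic u) = ν (Iic u)) : μ = ν := by
  rcases isEmpty_or_nonempty α with hα | hα
  · ext s hs
    simp [Set.eq_empty_of_isEmpty s]
  refine VectorMeasure.ext_of_generateFrom (range Iic) ?_ ?_ isPiSystem_Iic ?_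
  · rintro _ ⟨u, rfl⟩
    exact h u
  · rw [‹BorelSpace α›.measurable_eq, borel_eq_generateFrom_Iic]
  · obtain ⟨u, u_mono, hu⟩ := Filter.exists_seq_monotone_tendsto_atTop_atTop α
    have hun : (univ : Set α) = ⋃ n, Iic (u n) := by
      refine (eq_univ_of_forall fun x => ?_).symm
      simpa using (hu.eventually (Ici_mem_atTop x)).exists
    have hm : Monotone fun n => Iic (u n) := fun i j hij => Iic_subset_Iic.2 (u_mono hij)
    rw [hun]
    refine tendsto_nhds_unique
      (μ.tendsto_vectorMeasure_iUnion_atTop_nat hm fun _ => measurableSet_Iic) ?_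
    simp_rw [h]
    exact ν.tendsto_vectorMeasure_iUnion_atTop_nat hm fun _ => measurableSet_Iic

variable [DenselyOrdered α] [CompactIccSpace α] [CompleteSpace E] {f : α → E}

theorem BoundedVariationOn.stieltjesFunctionRightLim_measure_univ_le
    (hf : BoundedVariationOn f univ) {x₀ : α} (hx₀ : IsBot x₀) :
    (hf.stieltjesFunctionRightLim x₀).measure univ ≤ eVariationOn f univ := by
  have : Nonempty α := ⟨x₀⟩
  set V := hf.stieltjesFunctionRightLim x₀ with hV
  have hle : ∀ x, V x ≤ (eVariationOn f univ).toReal := fun x => by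
    refine (le_abs_self _).trans ((variationOnFromTo.abs_le_eVariationOn hf.rightLim).trans ?_)
    exact ENNReal.toReal_mono hf (eVariationOn.eVariationOn_rightLim_le isOpen_univ)
  have hbot : Tendsto V atBot (𝓝 0) := by
    rw [atBot_eq_pure_of_isBot hx₀, tendsto_pure_left]
    intro s hs
    have : V x₀ = 0 := by simp [hV, variationOnFromTo.self]
    rw [this]
    exact mem_of_mem_nhds hs
  have hbdd : BddAbove (range V) := ⟨_, by rintro _ ⟨x, rfl⟩; exact hle x⟩
  rw [V.measure_univ hbot (tendsto_atTop_ciSup V.mono hbdd), sub_zero]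
  exact ENNReal.ofReal_le_of_le_toReal (ciSup_le hle)

/-- The total variation of the vector measure of a function is controlled by the variation of the
function. -/
theorem BoundedVariationOn.variation_vectorMeasure_univ_le
    (hf : BoundedVariationOn f univ) {x₀ : α} (hx₀ : IsBot x₀) :
    hf.vectorMeasure.variation univ ≤ 2 * eVariationOn f univ := by
  have : Nonempty α := ⟨x₀⟩
  set V := hf.stieltjesFunctionRightLim x₀ with hV
  have hVuniv := hf.stieltjesFunctionRightLim_measure_univ_le hx₀
  have : IsFiniteMeasure V.measure := ⟨hVuniv.trans_lt hf.lt_top⟩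
  -- Increments of `f.rightLim` are dominated by the finite scalar measure of its variation
  -- function, which allows the extension to a vector measure.
  have A : ∀ s ∈ {s | ∃ u v, u ≤ v ∧ s = Ioc u v},
      ‖AddContent.onIoc f.rightLim s‖ₑ ≤ V.measure s := by
    rintro s ⟨u, v, huv, rfl⟩
    rw [AddContent.onIoc_apply huv]
    simp only [hV, StieltjesFunction.measure_Ioc,
      BoundedVariationOn.stieltjesFunctionRightLim_apply]
    rw [← variationOnFromTo.add hf.rightLim.locallyBoundedVariationOn
      (mem_univ x₀) (mem_univ u) (mem_univ v)]
    simp only [add_sub_cancel_left, variationOnFromTo, huv, ↓reduceIte, univ_inter]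
    rw [ENNReal.ofReal_toReal
      ((eVariationOn.mono _ (subset_univ _)).trans_lt hf.rightLim.lt_top).ne,
      ← edist_eq_enorm_sub]
    exact eVariationOn.edist_le _ (by grind) (by grind)
  have B : ‹MeasurableSpace α› = .generateFrom {s | ∃ u v, u ≤ v ∧ s = Ioc u v} := by
    borelize α
    convert! borel_eq_generateFrom_Ioc_le α using 2
    grind only
  obtain ⟨m, hm, hmV⟩ :=
    VectorMeasure.exists_extension_of_isSetSemiring_of_le_measure_of_generateFrom
      IsSetSemiring.Ioc A B
  have hm_bot : m {x₀} = 0 := by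
    rw [← enorm_eq_zero, ← nonpos_iff_eq_zero]
    refine (hmV _).trans ?_
    rw [← botSet_eq_singleton_of_isBot hx₀, V.measure_botSet]
  have hf_bot : f.leftLim x₀ = f x₀ := leftLim_eq_of_isBot hx₀
  -- The extension `m` does not charge the least point, so the jump of `f` there is restored by a
  -- Dirac mass. Each summand costs at most one variation of `f`, whence the factor 2.
  have hsum : hf.vectorMeasure = m + VectorMeasure.dirac x₀ (f.rightLim x₀ - f x₀) := by
    refine VectorMeasure.ext_of_Iic fun u => ?_
    have hIic : Iic u = {x₀} ∪ Ioc x₀ u := by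
      ext x
      have := hx₀ x
      have := hx₀ u
      simp only [mem_Iic, mem_union, mem_singleton_iff, mem_Ioc]
      grind
    have hdisj : Disjoint {x₀} (Ioc x₀ u) := by simp
    rw [_root_.add_apply, VectorMeasure.dirac_apply_of_mem measurableSet_Iic (hx₀ u), hIic,
      VectorMeasure.of_union hdisj (measurableSet_singleton _) measurableSet_Ioc,
      VectorMeasure.of_union hdisj (measurableSet_singleton _) measurableSet_Ioc,
      hf.vectorMeasure_singleton, hf.vectorMeasure_Ioc (hx₀ u), hm_bot,
      hm _ ⟨x₀, u, hx₀ u, rfl⟩, AddContent.onIoc_apply (hx₀ u), hf_bot]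
    abel
  have hm_var : m.variation univ ≤ eVariationOn f univ :=
    (VectorMeasure.variation_apply_le_of_forall_enorm_le .univ fun s _ _ => hmV s).trans hVuniv
  have hjump : ‖f.rightLim x₀ - f x₀‖ₑ ≤ eVariationOn f univ := by
    rw [← edist_eq_enorm_sub, edist_comm]
    calc edist (f x₀) (f.rightLim x₀)
        ≤ eVariationOn f (Ioi x₀) + edist (f x₀) (f.rightLim x₀) := le_add_self
      _ = eVariationOn f (Ici x₀) := hf.eVariationOn_Ici_eq_Ioi_add_edist.symm
      _ ≤ _ := eVariationOn.mono _ (subset_univ _)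
  calc hf.vectorMeasure.variation univ
      ≤ (m.variation + (VectorMeasure.dirac x₀ (f.rightLim x₀ - f x₀)).variation) univ := by
        rw [hsum]
        exact VectorMeasure.variation_add_le _
    _ = m.variation univ + ‖f.rightLim x₀ - f x₀‖ₑ := by simp
    _ ≤ 2 * eVariationOn f univ := by
        rw [two_mul]
        gcongr

end VectorMeasureOnLinearOrder

/-! ### The measures `dκ(t,·)` and the integral operator -/

namespace IsStieltjesVolterraKernel

variable {d : ℕ} {a b : ℝ} {κ : Icc a b → Icc a b → RealMat d}

/-- The matrix-valued measure `dκ(t,·)` on `[a,b]`. -/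
noncomputable def slice (hκ : IsStieltjesVolterraKernel κ) (t : Icc a b) :
    VectorMeasure (Icc a b) (RealMat d) :=
  (hκ.boundedVariation t).vectorMeasure

theorem isBot_left (t : Icc a b) : IsBot (⟨a, le_rfl, t.2.1.trans t.2.2⟩ : Icc a b) :=
  fun x => x.2.1

theorem isTop_right (t : Icc a b) : IsTop (⟨b, t.2.1.trans t.2.2, le_rfl⟩ : Icc a b) :=
  fun x => x.2.2

theorem leftLim_eq (hκ : IsStieltjesVolterraKernel κ) (t u : Icc a b) :
    Function.leftLim (κ t) u = κ t u :=
  ContinuousWithinAt.leftLim_eq (hκ.leftContinuous t u)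

theorem slice_Ici (hκ : IsStieltjesVolterraKernel κ) (t u : Icc a b) :
    hκ.slice t (Ici u) = -κ t u := by
  have hlim : Tendsto (κ t) atTop (𝓝 0) := by
    rw [atTop_eq_pure_of_isTop (isTop_right t), tendsto_pure_left]
    intro s hs
    rw [hκ.eq_zero t _ t.2.2]
    exact mem_of_mem_nhds hs
  have : Nonempty (Icc a b) := ⟨t⟩
  rw [slice, BoundedVariationOn.vectorMeasure_Ici, hlim.limUnder_eq, hκ.leftLim_eq, zero_sub]

/-- Inside `[t,b]` every final segment has mass `-κ t u = 0`, and these segments determine the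
measure. -/
theorem variation_slice_Ici (hκ : IsStieltjesVolterraKernel κ) (t : Icc a b) :
    (hκ.slice t).variation (Ici t) = 0 := by
  have h : (hκ.slice t).restrict (Ici t) = 0 := by
    refine VectorMeasure.ext_of_Ici (isBot_left t) fun u => ?_
    rw [VectorMeasure.restrict_apply _ measurableSet_Ici measurableSet_Ici, Ici_inter_Ici,
      slice_Ici, hκ.eq_zero t _ le_sup_right]
    simp
  rw [← Measure.restrict_apply_univ, ← VectorMeasure.variation_restrict measurableSet_Ici, h]
  simp

theorem variation_slice_univ_le (hκ : IsStieltjesVolterraKernel κ) (t : Icc a b) :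
    (hκ.slice t).variation univ ≤ 2 * eVariationOn (κ t) univ :=
  (hκ.boundedVariation t).variation_vectorMeasure_univ_le (isBot_left t)

instance isFiniteMeasure_variation_slice (hκ : IsStieltjesVolterraKernel κ) (t : Icc a b) :
    IsFiniteMeasure (hκ.slice t).variation :=
  ⟨(hκ.variation_slice_univ_le t).trans_lt
    (ENNReal.mul_lt_top (by simp) (hκ.boundedVariation t).lt_top)⟩

theorem boundedVariationOn_Ico (hκ : IsStieltjesVolterraKernel κ) (s t : Icc a b) :
    BoundedVariationOn (fun x : Ico s t => κ t x) univ :=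
  ((eVariationOn.comp_le_of_monotoneOn (κ t) (fun x : Ico s t => (x : Icc a b))
    (fun _ _ _ _ h => h) (fun _ _ => mem_univ _)).trans_lt (hκ.boundedVariation t).lt_top).ne

/-- The measure on `[s,t)` of the restriction of `κ(t,·)` to `[s,t)` is the restriction of the
measure `dκ(t,·)`. -/
theorem map_vectorMeasure_Ico (hκ : IsStieltjesVolterraKernel κ) {s t : Icc a b} (hst : s < t) :
    (hκ.boundedVariationOn_Ico s t).vectorMeasure.map ((↑) : Ico s t → Icc a b)
      = (hκ.slice t).restrict (Ico s t) := by
  set hf := hκ.boundedVariationOn_Ico s t with hf_def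
  have hleft : ∀ u : Ico s t, (fun x : Ico s t => κ t x).leftLim u = κ t u := fun u => by
    refine ContinuousWithinAt.leftLim_eq ?_
    have := (hκ.leftContinuous t u).comp (f := ((↑) : Ico s t → Icc a b)) (s := Iic u)
      continuous_subtype_val.continuousWithinAt (fun x (hx : x ≤ u) => hx)
    exact this
  -- The top of `[s,t)` is approached from the left of `t`, where `κ(t,·)` tends to `κ t t = 0`; no
  -- mass is lost on removing `t`.
  have hlim : Tendsto (fun x : Ico s t => κ t x) atTop (𝓝 0) := by
    have h1 : Tendsto ((↑) : Ico s t → Icc a b) atTop (𝓝[<] t) := by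
      rw [← comap_coe_nhdsLT_of_Ioo_subset (s := Ico s t) (fun x hx => hx.2)
        (fun _ => ⟨s, hst, Ioo_subset_Ico_self⟩) (.of_dense _)]
      exact tendsto_comap
    have h2 := ((hκ.leftContinuous t t).mono Iio_subset_Iic_self).tendsto.comp h1
    rwa [hκ.eq_zero t t le_rfl] at h2
  have hIci : ∀ u : Ico s t, hf.vectorMeasure (Ici u) = -κ t u := fun u => by
    rw [BoundedVariationOn.vectorMeasure_Ici]
    have : Nonempty (Ico s t) := ⟨u⟩
    rw [hlim.limUnder_eq, hleft, zero_sub]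
  refine VectorMeasure.ext_of_Ici (isBot_left t) fun u => ?_
  rw [VectorMeasure.map_apply _ measurable_subtype_coe measurableSet_Ici,
    VectorMeasure.restrict_apply _ measurableSet_Ico measurableSet_Ici]
  rcases le_or_gt t u with htu | hut
  · have h1 : ((↑) : Ico s t → Icc a b) ⁻¹' Ici u = ∅ :=
      eq_empty_of_forall_notMem fun x hx => absurd (hx.trans_lt x.2.2) htu.not_gt
    have h2 : Ici u ∩ Ico s t = ∅ :=
      eq_empty_of_forall_notMem fun x hx => absurd (lt_of_le_of_lt hx.1 hx.2.2) htu.not_gt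
    rw [h1, h2, VectorMeasure.empty, VectorMeasure.empty]
  · have hmem : max u s ∈ Ico s t := ⟨le_max_right _ _, max_lt hut hst⟩
    have h1 : ((↑) : Ico s t → Icc a b) ⁻¹' Ici u = Ici ⟨max u s, hmem⟩ := by
      ext x
      have := x.2.1
      simp only [mem_preimage, mem_Ici, ← Subtype.coe_le_coe, max_le_iff]
      tauto
    have h2 : Ici u ∩ Ico s t = Ici (max u s) \ Ici t := by
      ext x
      simp only [mem_inter_iff, mem_Ici, mem_Ico, Set.mem_sdiff, max_le_iff, not_le]
      tauto
    rw [h1, h2, hIci, VectorMeasure.of_sdiff measurableSet_Ici measurableSet_Ici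
      (Ici_subset_Ici.2 hmem.2.le), slice_Ici, slice_Ici, hκ.eq_zero t t le_rfl]
    simp

/-- Applies the global bound to `[s,t)` as an ordered space of its own, so that only the variation
on `[s,t)` enters; this makes the diagonal condition usable. -/
theorem variation_slice_Ico_le (hκ : IsStieltjesVolterraKernel κ) {s t : Icc a b} (hst : s < t) :
    (hκ.slice t).variation (Ico s t) ≤ 2 * eVariationOn (κ t) (Ico s t) := by
  have hbot : IsBot (⟨s, le_rfl, hst⟩ : Ico s t) := fun x => x.2.1
  have hval : MeasurableEmbedding ((↑) : Ico s t → Icc a b) :=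
    MeasurableEmbedding.subtype_coe measurableSet_Ico
  rw [← Measure.restrict_apply_univ, ← VectorMeasure.variation_restrict measurableSet_Ico,
    ← hκ.map_vectorMeasure_Ico hst, hval.variation_map, hval.map_apply, preimage_univ]
  refine (BoundedVariationOn.variation_vectorMeasure_univ_le _ hbot).trans ?_
  gcongr
  exact eVariationOn.comp_le_of_monotoneOn (κ t) (fun x : Ico s t => (x : Icc a b))
    (fun _ _ _ _ h => h) (fun x _ => x.2)

/-- The integral operator `g ↦ (t ↦ ∫ dκ(t,τ) g(τ))`. -/
noncomputable def integralOp (hκ : IsStieltjesVolterraKernel κ) (g : Icc a b → RealMat d)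
    (t : Icc a b) : RealMat d :=
  (hκ.slice t).integral g (ContinuousLinearMap.mul ℝ (RealMat d)).flip

/-- Outside `[β,t)` either `τ ≥ t`, a null set, or `τ < β`, where `g` vanishes. The domain no longer
depends on `β`. -/
theorem stieltjesIntegral_eq_integralOp (hκ : IsStieltjesVolterraKernel κ) (t β : Icc a b)
    {g : Icc a b → RealMat d} (hg : ∀ τ ≤ β, g τ = 0) :
    stieltjesIntegral (Ico β t) (κ t) g = hκ.integralOp g t := by
  have hpos : ∀ᵐ x ∂(hκ.slice t).variation, x ∉ Ico β t → g x = 0 := by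
    have : (Ici t)ᶜ ∈ ae (hκ.slice t).variation := by
      rw [compl_mem_ae_iff]
      exact hκ.variation_slice_Ici t
    filter_upwards [this] with x hx hx'
    refine hg x ?_
    simp only [mem_compl_iff, mem_Ici, not_le, mem_Ico, not_and_or, not_lt] at hx hx'
    exact hx'.elim le_of_lt fun h => absurd h hx.not_ge
  rw [integralOp, ← VectorMeasure.setIntegral_eq_integral_of_ae_compl_eq_zero
    measurableSet_Ico hpos, stieltjesIntegral, dif_pos (hκ.boundedVariationOn_Ico β t)]
  rcases lt_or_ge β t with h | h
  · rw [← hκ.map_vectorMeasure_Ico h,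
      (MeasurableEmbedding.subtype_coe measurableSet_Ico).integral_map_vectorMeasure]
  · have : IsEmpty (Ico β t) := by simp [h]
    rw [VectorMeasure.integral_of_isEmpty, Ico_eq_empty h.not_gt]
    simp

theorem enorm_integralOp_le (hκ : IsStieltjesVolterraKernel κ) (g : Icc a b → RealMat d)
    (t : Icc a b) : ‖hκ.integralOp g t‖ₑ ≤ ∫⁻ τ, ‖g τ‖ₑ ∂(hκ.slice t).variation := by
  refine VectorMeasure.enorm_integral_le_lintegral_enorm.trans ?_
  have : ‖(ContinuousLinearMap.mul ℝ (RealMat d)).flip‖ₑ ≤ 1 := by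
    rw [← ofReal_norm, ContinuousLinearMap.opNorm_flip, ENNReal.ofReal_le_one]
    exact ContinuousLinearMap.opNorm_mul_le ℝ (RealMat d)
  grw [this, one_mul]

end IsStieltjesVolterraKernel

/-! ### Joint measurability of the integral in `(t,β)` -/

theorem stronglyMeasurable_matrix_iff {α : Type*} [MeasurableSpace α] {d : ℕ} {f : α → RealMat d} :
    StronglyMeasurable f ↔ ∀ i j, Measurable fun x => f x i j := by
  refine ⟨fun h i j => ?_, fun h => ?_⟩
  · exact ((continuous_id.matrix_elem i j).comp_stronglyMeasurable h).measurable
  · have hf : f = fun x => ∑ i, ∑ j, f x i j • Matrix.single i j (1 : ℝ) := by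
      funext x
      conv_lhs => rw [Matrix.matrix_eq_sum_single (f x)]
      simp [Matrix.smul_single]
    rw [hf]
    refine Finset.stronglyMeasurable_fun_sum _ fun i _ =>
      Finset.stronglyMeasurable_fun_sum _ fun j _ => ?_
    exact (h i j).stronglyMeasurable.smul_const _

namespace IsStieltjesVolterraKernel

variable {d : ℕ} {a b : ℝ} {κ : Icc a b → Icc a b → RealMat d}

theorem stronglyMeasurable (hκ : IsStieltjesVolterraKernel κ) :
    StronglyMeasurable (Function.uncurry κ) :=
  stronglyMeasurable_matrix_iff.2 hκ.measurable

/-- A π-λ argument from the segments `[u,b]`, whose mass `-κ t u` is measurable in `t`. -/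
theorem stronglyMeasurable_slice_apply (hκ : IsStieltjesVolterraKernel κ) {A : Set (Icc a b)}
    (hA : MeasurableSet A) : StronglyMeasurable fun t => hκ.slice t A := by
  have hgen : (inferInstance : MeasurableSpace (Icc a b)) = .generateFrom (range Ici) := by
    rw [BorelSpace.measurable_eq (α := Icc a b), borel_eq_generateFrom_Ici]
  have huniv : StronglyMeasurable fun t => hκ.slice t univ := by
    rcases isEmpty_or_nonempty (Icc a b) with h | ⟨⟨x⟩⟩
    · exact .of_discrete
    · have : (univ : Set (Icc a b)) = Ici ⟨a, le_rfl, x.2.1.trans x.2.2⟩ :=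
        (eq_univ_of_forall fun y => isBot_left x y).symm
      simp_rw [this, slice_Ici]
      exact (hκ.stronglyMeasurable.comp_measurable measurable_prodMk_right).neg
  induction A, hA using MeasurableSpace.induction_on_inter hgen isPiSystem_Ici with
  | empty => simpa using stronglyMeasurable_const
  | basic s hs =>
    obtain ⟨u, rfl⟩ := hs
    simp_rw [slice_Ici]
    exact (hκ.stronglyMeasurable.comp_measurable measurable_prodMk_right).neg
  | compl s hs ih =>
    simp_rw [VectorMeasure.of_compl hs]
    exact huniv.sub ih
  | iUnion f hfd hfm ih =>
    refine stronglyMeasurable_of_tendsto atTop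
      (f := fun n t => ∑ i ∈ Finset.range n, hκ.slice t (f i))
      (fun n => Finset.stronglyMeasurable_fun_sum _ fun i _ => ih i) ?_
    exact tendsto_pi_nhds.2 fun t => ((hκ.slice t).m_iUnion hfm hfd).tendsto_sum_nat

theorem stronglyMeasurable_slice_section (hκ : IsStieltjesVolterraKernel κ)
    {A : Set (Icc a b × Icc a b)} (hA : MeasurableSet A) :
    StronglyMeasurable fun p : Icc a b × Icc a b => hκ.slice p.1 ((fun τ => (τ, p.2)) ⁻¹' A) := by
  have hsec : ∀ {s : Set (Icc a b × Icc a b)}, MeasurableSet s → ∀ β : Icc a b,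
      MeasurableSet ((fun τ : Icc a b => (τ, β)) ⁻¹' s) := fun hs β => measurable_prodMk_right hs
  induction A, hA using MeasurableSpace.induction_on_inter generateFrom_prod.symm isPiSystem_prod with
  | empty => simpa using stronglyMeasurable_const
  | basic s hs =>
    obtain ⟨A, hA, B, hB, rfl⟩ := hs
    have : (fun p : Icc a b × Icc a b => hκ.slice p.1 ((fun τ => (τ, p.2)) ⁻¹' A ×ˢ B))
        = (Prod.snd ⁻¹' B).indicator fun p => hκ.slice p.1 A := by
      funext p
      by_cases hp : p.2 ∈ B <;> simp [hp, Set.indicator]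
    rw [this]
    exact ((hκ.stronglyMeasurable_slice_apply hA).comp_measurable measurable_fst).indicator
      (measurable_snd hB)
  | compl s hs ih =>
    simp_rw [preimage_compl, VectorMeasure.of_compl (hsec hs _)]
    exact ((hκ.stronglyMeasurable_slice_apply .univ).comp_measurable measurable_fst).sub ih
  | iUnion f hfd hfm ih =>
    have hsum : ∀ n, StronglyMeasurable fun p : Icc a b × Icc a b =>
        ∑ i ∈ Finset.range n, hκ.slice p.1 ((fun τ => (τ, p.2)) ⁻¹' f i) :=
      fun n => Finset.stronglyMeasurable_fun_sum _ fun i _ => ih i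
    refine stronglyMeasurable_of_tendsto atTop hsum ?_
    refine tendsto_pi_nhds.2 fun p => ?_
    rw [preimage_iUnion]
    exact ((hκ.slice p.1).m_iUnion (fun i => hsec (hfm i) _)
      fun i j hij => (hfd hij).preimage _).tendsto_sum_nat

theorem stronglyMeasurable_integralOp_simpleFunc (hκ : IsStieltjesVolterraKernel κ)
    (F : SimpleFunc (Icc a b × Icc a b) (RealMat d)) :
    StronglyMeasurable fun p : Icc a b × Icc a b => hκ.integralOp (fun τ => F (τ, p.2)) p.1 := by
  have hint : ∀ (F : SimpleFunc (Icc a b × Icc a b) (RealMat d)) (t β : Icc a b),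
      (hκ.slice t).Integrable fun τ => F (τ, β) := fun F t β => by
    obtain ⟨C, hC⟩ := F.exists_forall_norm_le
    exact .of_bound (F.stronglyMeasurable.comp_measurable measurable_prodMk_right).aestronglyMeasurable
      C (.of_forall fun τ => hC _)
  induction F using SimpleFunc.induction with
  | const c hs =>
    rename_i s
    have : (fun p : Icc a b × Icc a b => hκ.integralOp (fun τ => (SimpleFunc.piecewise s hs
        (SimpleFunc.const _ c) (SimpleFunc.const _ 0)) (τ, p.2)) p.1)
        = fun p => hκ.slice p.1 ((fun τ => (τ, p.2)) ⁻¹' s) * c := by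
      funext p
      have h := VectorMeasure.integral_indicator_const (μ := hκ.slice p.1)
        (B := (ContinuousLinearMap.mul ℝ (RealMat d)).flip) c
        (s := (fun τ => (τ, p.2)) ⁻¹' s) (measurable_prodMk_right hs)
      rw [ContinuousLinearMap.flip_apply, ContinuousLinearMap.mul_apply'] at h
      rw [← h, integralOp]
      congr 1
    rw [this]
    exact (hκ.stronglyMeasurable_slice_section hs).mul_const c
  | add hfg hf hg =>
    rename_i f g
    have : (fun p : Icc a b × Icc a b => hκ.integralOp (fun τ => (f + g) (τ, p.2)) p.1)
        = fun p => hκ.integralOp (fun τ => f (τ, p.2)) p.1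
          + hκ.integralOp (fun τ => g (τ, p.2)) p.1 := by
      funext p
      exact VectorMeasure.integral_fun_add (hint f _ _) (hint g _ _)
    rw [this]
    exact hf.add hg

/-- Bounded approximation by simple functions of both variables, then dominated convergence against
the finite variation measure. -/
theorem stronglyMeasurable_integralOp (hκ : IsStieltjesVolterraKernel κ)
    {g : Icc a b → Icc a b → RealMat d} (hg : StronglyMeasurable (Function.uncurry g)) {C : ℝ}
    (hC : ∀ τ β, ‖g τ β‖ ≤ C) :
    StronglyMeasurable (Function.uncurry fun t β => hκ.integralOp (fun τ => g τ β) t) := by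
  have happrox : ∀ n, StronglyMeasurable fun p : Icc a b × Icc a b =>
      hκ.integralOp (fun τ => hg.approxBounded C n (τ, p.2)) p.1 :=
    fun n => hκ.stronglyMeasurable_integralOp_simpleFunc _
  refine stronglyMeasurable_of_tendsto atTop happrox ?_
  refine tendsto_pi_nhds.2 fun p => ?_
  have hC0 : 0 ≤ C := (norm_nonneg _).trans (hC p.1 p.2)
  refine VectorMeasure.tendsto_integral_filter_of_norm_le_const
    (.of_forall fun n => ((SimpleFunc.stronglyMeasurable _).comp_measurable
      measurable_prodMk_right).aestronglyMeasurable)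
    ⟨C, .of_forall fun n => .of_forall fun τ => hg.norm_approxBounded_le hC0 _ _⟩
    (.of_forall fun τ => ?_)
  exact hg.tendsto_approxBounded_of_norm_le (hC τ p.2)

end IsStieltjesVolterraKernel

/-! ### The exponential weight -/

namespace IsStieltjesVolterraKernel

variable {d : ℕ} {a b : ℝ} {κ : Icc a b → Icc a b → RealMat d}

theorem exists_eVariationOn_le (hκ : IsStieltjesVolterraKernel κ) :
    ∃ C : ℝ≥0, ∀ t, eVariationOn (κ t) univ ≤ C := by
  rcases isEmpty_or_nonempty (Icc a b) with h | ⟨⟨x⟩⟩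
  · exact ⟨0, fun t => h.elim t⟩
  · obtain ⟨C, hC⟩ := hκ.bounded x
    exact ⟨C, fun t => le_self_add.trans (hC t)⟩

/-- There is a bounded weight for which the integral operator of `κ` has norm at most `1/2` on the
weighted space of bounded functions. -/
theorem exists_weight (hκ : IsStieltjesVolterraKernel κ) :
    ∃ (w : Icc a b → ℝ≥0∞) (W : ℝ≥0), (∀ t, 1 ≤ w t) ∧ (∀ t, w t ≤ W) ∧
      ∀ t, ∫⁻ τ, w τ ∂(hκ.slice t).variation ≤ w t * 2⁻¹ := by
  obtain ⟨C, hC⟩ := hκ.exists_eVariationOn_le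
  -- The target `1/2` is split as `1/4 + 1/4`. Near the diagonal the mass is at most `2 · 1/8`; at
  -- distance more than `δ` the weight drops by the factor `exp(-rδ) = 1/(8C+1)` against a mass of
  -- at most `2C`. Taking `δ = η/2` keeps `t - s < η` strict.
  obtain ⟨η, hη, hdiag⟩ := hκ.variation_diagonal (1 / 8) (by norm_num)
  set δ := η / 2 with hδ
  have hδ0 : 0 < δ := half_pos hη
  set r := Real.log (8 * C + 1) / δ with hr
  have hr0 : 0 ≤ r := div_nonneg (Real.log_nonneg (by simp)) hδ0.le
  have hexp : Real.exp (-(r * δ)) = (8 * C + 1 : ℝ)⁻¹ := by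
    rw [hr, div_mul_cancel₀ _ hδ0.ne', Real.exp_neg, Real.exp_log (by positivity)]
  let w : Icc a b → ℝ≥0∞ := fun t => ENNReal.ofReal (Real.exp (r * (t - a)))
  refine ⟨w, (Real.exp (r * (b - a))).toNNReal, fun t => ?_, fun t => ?_, fun t => ?_⟩
  · rw [ENNReal.one_le_ofReal]
    exact Real.one_le_exp (mul_nonneg hr0 (sub_nonneg.2 t.2.1))
  · refine ENNReal.ofReal_le_ofReal (Real.exp_le_exp.2 ?_)
    have := t.2.2
    gcongr
  · set s : Icc a b := ⟨max a (t - δ), le_max_left _ _,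
      max_le (t.2.1.trans t.2.2) (by linarith [t.2.2])⟩ with hs
    have hst : s ≤ t := max_le t.2.1 (by linarith)
    have hpt : ∀ᵐ τ ∂(hκ.slice t).variation,
        w τ ≤ w t * (ENNReal.ofReal (8 * C + 1 : ℝ)⁻¹ + (Ico s t).indicator 1 τ) := by
      have : (Ici t)ᶜ ∈ ae (hκ.slice t).variation := by
        rw [compl_mem_ae_iff]
        exact hκ.variation_slice_Ici t
      filter_upwards [this] with τ hτ
      have hτt : τ < t := not_le.1 hτ
      have hτt' : (τ : ℝ) ≤ t := hτt.le
      rcases lt_or_ge τ s with h | h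
      · have hlt : (τ : ℝ) < t - δ := by
          rcases lt_max_iff.1 (show (τ : ℝ) < max a (t - δ) from h) with h' | h'
          · exact absurd τ.2.1 h'.not_ge
          · exact h'
        calc w τ ≤ w t * ENNReal.ofReal (8 * C + 1 : ℝ)⁻¹ := by
              rw [← hexp, ← ENNReal.ofReal_mul (Real.exp_nonneg _), ← Real.exp_add]
              refine ENNReal.ofReal_le_ofReal (Real.exp_le_exp.2 ?_)
              nlinarith
          _ ≤ _ := by
              gcongr
              exact le_self_add
      · calc w τ ≤ w t * 1 := by
              rw [mul_one]
              refine ENNReal.ofReal_le_ofReal (Real.exp_le_exp.2 ?_)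
              gcongr
          _ ≤ _ := by
              rw [indicator_of_mem (show τ ∈ Ico s t from ⟨h, hτt⟩)]
              gcongr
              exact le_add_self
    have hIco : (hκ.slice t).variation (Ico s t) ≤ 4⁻¹ := by
      rcases hst.eq_or_lt with h | h
      · simp [h]
      · refine (hκ.variation_slice_Ico_le h).trans ?_
        have hs' : (s : ℝ) < t := h
        have hs'' : (t : ℝ) - δ ≤ s := le_max_right _ _
        grw [(hdiag t s (by linarith) (by linarith)).le]
        rw [← ENNReal.ofReal_ofNat 2, ← ENNReal.ofReal_mul (by norm_num),
          ← ENNReal.ofReal_ofNat 4, ← ENNReal.ofReal_inv_of_pos (by norm_num)]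
        exact ENNReal.ofReal_le_ofReal (by norm_num)
    have huniv : ENNReal.ofReal (8 * C + 1 : ℝ)⁻¹ * (hκ.slice t).variation univ ≤ 4⁻¹ := by
      grw [hκ.variation_slice_univ_le t, hC t]
      rw [← ENNReal.ofReal_coe_nnreal, ← ENNReal.ofReal_ofNat 2,
        ← ENNReal.ofReal_mul (by norm_num), ← ENNReal.ofReal_mul (by positivity),
        ← ENNReal.ofReal_ofNat 4, ← ENNReal.ofReal_inv_of_pos (by norm_num)]
      refine ENNReal.ofReal_le_ofReal ?_
      rw [inv_mul_le_iff₀ (by positivity)]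
      linarith [C.2]
    calc ∫⁻ τ, w τ ∂(hκ.slice t).variation
        ≤ ∫⁻ τ, w t * (ENNReal.ofReal (8 * C + 1 : ℝ)⁻¹ + (Ico s t).indicator 1 τ)
            ∂(hκ.slice t).variation := lintegral_mono_ae hpt
      _ = w t * (ENNReal.ofReal (8 * C + 1 : ℝ)⁻¹ * (hκ.slice t).variation univ
            + (hκ.slice t).variation (Ico s t)) := by
          rw [lintegral_const_mul' _ _ ENNReal.ofReal_ne_top, lintegral_add_left measurable_const,
            lintegral_const, lintegral_indicator_one measurableSet_Ico]
      _ ≤ w t * (4⁻¹ + 4⁻¹) := by gcongr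
      _ = w t * 2⁻¹ := by
          congr 1
          rw [← two_mul, ← ENNReal.toReal_eq_toReal_iff' (by finiteness) (by finiteness)]
          norm_num

end IsStieltjesVolterraKernel

/-! ### Weighted kernels and the contraction estimate -/

/-- Kernels `g` vanishing for `τ ≥ t` and left continuous in the second variable, for which the
variation of `g(t,·)` is at most `M * w(t)`. -/
structure IsWeightedKernel {d : ℕ} {a b : ℝ} (w : Icc a b → ℝ≥0∞) (M : ℝ≥0)
    (g : Icc a b → Icc a b → RealMat d) : Prop where
  stronglyMeasurable : StronglyMeasurable (Function.uncurry g)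
  eq_zero : ∀ t τ, t ≤ τ → g t τ = 0
  leftContinuous : ∀ t τ, ContinuousWithinAt (g t) (Iic τ) τ
  eVariationOn_le : ∀ t, eVariationOn (g t) univ ≤ M * w t

namespace IsWeightedKernel

variable {d : ℕ} {a b : ℝ} {κ g : Icc a b → Icc a b → RealMat d} {w : Icc a b → ℝ≥0∞}
  {W M : ℝ≥0}

/-- Compare with the endpoint `b`, where `g t` vanishes. -/
theorem enorm_le (hg : IsWeightedKernel w M g) (t τ : Icc a b) : ‖g t τ‖ₑ ≤ M * w t := by
  have h := eVariationOn.edist_le (g t) (mem_univ τ)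
    (mem_univ (⟨b, t.2.1.trans t.2.2, le_rfl⟩ : Icc a b))
  rw [hg.eq_zero t _ (IsStieltjesVolterraKernel.isTop_right t t), edist_zero_right] at h
  exact h.trans (hg.eVariationOn_le t)

theorem norm_le (hg : IsWeightedKernel w M g) (hW : ∀ t, w t ≤ W) (t τ : Icc a b) :
    ‖g t τ‖ ≤ M * W := by
  have h := (hg.enorm_le t τ).trans (mul_le_mul_right (hW t) _)
  rw [← ENNReal.coe_mul, enorm_le_coe] at h
  exact_mod_cast h

theorem stronglyMeasurable_left (hg : IsWeightedKernel w M g) (β : Icc a b) :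
    StronglyMeasurable fun τ => g τ β :=
  hg.stronglyMeasurable.comp_measurable measurable_prodMk_right

theorem integrable (hg : IsWeightedKernel w M g) (hW : ∀ t, w t ≤ W) (β : Icc a b)
    (μ : Measure (Icc a b)) [IsFiniteMeasure μ] : Integrable (fun τ => g τ β) μ :=
  .of_bound (hg.stronglyMeasurable_left β).aestronglyMeasurable (M * W)
    (.of_forall fun τ => hg.norm_le hW τ β)

/-- By linearity each increment in `β` is the integral of an increment of `g τ`; a finite sum of
these passes under the integral. -/
theorem eVariationOn_integralOp_le (hg : IsWeightedKernel w M g) (hW : ∀ t, w t ≤ W)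
    (hκ : IsStieltjesVolterraKernel κ) (t : Icc a b) (S : Set (Icc a b)) :
    eVariationOn (fun β => hκ.integralOp (fun τ => g τ β) t) S
      ≤ ∫⁻ τ, eVariationOn (g τ) S ∂(hκ.slice t).variation := by
  refine iSup_le fun p => ?_
  have hterm : ∀ β β', edist (hκ.integralOp (fun τ => g τ β) t) (hκ.integralOp (fun τ => g τ β') t)
      ≤ ∫⁻ τ, edist (g τ β) (g τ β') ∂(hκ.slice t).variation := fun β β' => by
    have hsub : hκ.integralOp (fun τ => g τ β - g τ β') t
        = hκ.integralOp (fun τ => g τ β) t - hκ.integralOp (fun τ => g τ β') t :=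
      VectorMeasure.integral_fun_sub (hg.integrable hW β _) (hg.integrable hW β' _)
    simp_rw [edist_eq_enorm_sub]
    rw [← hsub]
    exact hκ.enorm_integralOp_le _ t
  calc ∑ i ∈ Finset.range p.1, edist (hκ.integralOp (fun τ => g τ ((p.2 : ℕ → Icc a b) (i + 1))) t)
        (hκ.integralOp (fun τ => g τ ((p.2 : ℕ → Icc a b) i)) t)
      ≤ ∑ i ∈ Finset.range p.1, ∫⁻ τ, edist (g τ ((p.2 : ℕ → Icc a b) (i + 1)))
          (g τ ((p.2 : ℕ → Icc a b) i)) ∂(hκ.slice t).variation :=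
        Finset.sum_le_sum fun i _ => hterm _ _
    _ = ∫⁻ τ, ∑ i ∈ Finset.range p.1, edist (g τ ((p.2 : ℕ → Icc a b) (i + 1)))
          (g τ ((p.2 : ℕ → Icc a b) i)) ∂(hκ.slice t).variation := by
        rw [lintegral_finsetSum']
        intro i _
        simp_rw [edist_eq_enorm_sub]
        exact ((hg.stronglyMeasurable_left _).sub
          (hg.stronglyMeasurable_left _)).enorm.aemeasurable
    -- Monotonicity of the lower integral needs no measurability of the variation in `τ`.
    _ ≤ ∫⁻ τ, eVariationOn (g τ) S ∂(hκ.slice t).variation :=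
        lintegral_mono fun τ => eVariationOn.sum_le p.2.2.1 p.2.2.2

theorem integralOp (hg : IsWeightedKernel w M g) (hW : ∀ t, w t ≤ W)
    (hκ : IsStieltjesVolterraKernel κ)
    (hw : ∀ t, ∫⁻ τ, w τ ∂(hκ.slice t).variation ≤ w t * 2⁻¹) :
    IsWeightedKernel w (M * 2⁻¹) fun t β => hκ.integralOp (fun τ => g τ β) t where
  stronglyMeasurable := hκ.stronglyMeasurable_integralOp hg.stronglyMeasurable (hg.norm_le hW)
  eq_zero t β htβ := by
    refine VectorMeasure.integral_eq_zero_of_ae ?_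
    have : (Ici t)ᶜ ∈ ae (hκ.slice t).variation := by
      rw [compl_mem_ae_iff]
      exact hκ.variation_slice_Ici t
    filter_upwards [this] with τ hτ
    exact hg.eq_zero τ β ((notMem_Ici.1 hτ).le.trans htβ)
  leftContinuous t β :=
    VectorMeasure.tendsto_integral_filter_of_norm_le_const
      (.of_forall fun β' => (hg.stronglyMeasurable_left β').aestronglyMeasurable)
      ⟨M * W, .of_forall fun β' => .of_forall fun τ => hg.norm_le hW τ β'⟩
      (.of_forall fun τ => hg.leftContinuous τ β)
  eVariationOn_le t := by
    calc eVariationOn (fun β => hκ.integralOp (fun τ => g τ β) t) univ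
        ≤ ∫⁻ τ, eVariationOn (g τ) univ ∂(hκ.slice t).variation :=
          hg.eVariationOn_integralOp_le hW hκ t univ
      _ ≤ ∫⁻ τ, M * w τ ∂(hκ.slice t).variation := lintegral_mono fun τ => hg.eVariationOn_le τ
      _ = M * ∫⁻ τ, w τ ∂(hκ.slice t).variation := lintegral_const_mul' _ _ ENNReal.coe_ne_top
      _ ≤ M * (w t * 2⁻¹) := by grw [hw t]
      _ = ↑(M * 2⁻¹) * w t := by
          rw [ENNReal.coe_mul, ENNReal.coe_inv (by norm_num), ENNReal.coe_ofNat]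
          ring

end IsWeightedKernel

/-! ### Series of weighted kernels and regularity of solutions -/

variable {d : ℕ} {a b : ℝ} {κ ρ : Icc a b → Icc a b → RealMat d} {w : Icc a b → ℝ≥0∞}
  {W M : ℝ≥0}

theorem IsStieltjesVolterraKernel.exists_isWeightedKernel (hκ : IsStieltjesVolterraKernel κ)
    (hw1 : ∀ t, 1 ≤ w t) : ∃ M : ℝ≥0, IsWeightedKernel w M κ := by
  obtain ⟨C, hC⟩ := hκ.exists_eVariationOn_le
  refine ⟨C, hκ.stronglyMeasurable, hκ.eq_zero, hκ.leftContinuous, fun t => (hC t).trans ?_⟩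
  exact le_mul_of_one_le_right' (hw1 t)

theorem eVariationOn_fun_neg {α E : Type*} [LinearOrder α] [SeminormedAddCommGroup E] (f : α → E)
    (s : Set α) : eVariationOn (fun x => -f x) s = eVariationOn f s := by
  simp [eVariationOn, edist_neg_neg]

theorem eVariationOn_add_le {α E : Type*} [LinearOrder α] [SeminormedAddCommGroup E]
    (f g : α → E) (s : Set α) :
    eVariationOn (fun x => f x + g x) s ≤ eVariationOn f s + eVariationOn g s := by
  refine iSup_le fun p => ?_
  calc _ ≤ ∑ i ∈ Finset.range p.1, (edist (f ((p.2 : ℕ → α) (i + 1))) (f ((p.2 : ℕ → α) i))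
        + edist (g ((p.2 : ℕ → α) (i + 1))) (g ((p.2 : ℕ → α) i))) :=
        Finset.sum_le_sum fun i _ => edist_add_add_le _ _ _ _
    _ ≤ _ := by
        rw [Finset.sum_add_distrib]
        exact add_le_add (eVariationOn.sum_le p.2.2.1 p.2.2.2) (eVariationOn.sum_le p.2.2.1 p.2.2.2)

theorem eVariationOn_sum_le {ι α E : Type*} [LinearOrder α] [SeminormedAddCommGroup E]
    (f : ι → α → E) (s : Set α) (F : Finset ι) :
    eVariationOn (fun x => ∑ i ∈ F, f i x) s ≤ ∑ i ∈ F, eVariationOn (f i) s := by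
  classical
  induction F using Finset.induction_on with
  | empty => simp [eVariationOn]
  | insert i F hi ih =>
    simp_rw [Finset.sum_insert hi]
    exact (eVariationOn_add_le _ _ s).trans (add_le_add le_rfl ih)

namespace IsWeightedKernel

theorem neg {g : Icc a b → Icc a b → RealMat d} (hg : IsWeightedKernel w M g) :
    IsWeightedKernel w M fun t τ => -g t τ where
  stronglyMeasurable := hg.stronglyMeasurable.neg
  eq_zero t τ h := by rw [hg.eq_zero t τ h, neg_zero]
  leftContinuous t τ := (hg.leftContinuous t τ).neg
  eVariationOn_le t := (eVariationOn_fun_neg _ _).trans_le (hg.eVariationOn_le t)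

theorem summable {g : ℕ → Icc a b → Icc a b → RealMat d} {M : ℕ → ℝ≥0}
    (hg : ∀ n, IsWeightedKernel w (M n) (g n)) (hW : ∀ t, w t ≤ W) (hM : Summable M)
    (t τ : Icc a b) : Summable fun n => g n t τ :=
  .of_norm_bounded (((NNReal.summable_coe.2 hM).mul_right (W : ℝ)))
    fun n => (hg n).norm_le hW t τ

theorem tsum {g : ℕ → Icc a b → Icc a b → RealMat d} {M : ℕ → ℝ≥0}
    (hg : ∀ n, IsWeightedKernel w (M n) (g n)) (hW : ∀ t, w t ≤ W) (hM : Summable M) :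
    IsWeightedKernel w (∑' n, M n) fun t τ => ∑' n, g n t τ where
  stronglyMeasurable := by
    have hsum : ∀ n, StronglyMeasurable fun p : Icc a b × Icc a b =>
        ∑ i ∈ Finset.range n, g i p.1 p.2 :=
      fun n => Finset.stronglyMeasurable_fun_sum _ fun i _ => (hg i).stronglyMeasurable
    refine stronglyMeasurable_of_tendsto atTop hsum (tendsto_pi_nhds.2 fun p => ?_)
    exact (summable hg hW hM p.1 p.2).hasSum.tendsto_sum_nat
  eq_zero t τ h := by simp [(hg _).eq_zero t τ h]
  leftContinuous t τ :=
    tendsto_tsum_of_dominated_convergence ((NNReal.summable_coe.2 hM).mul_right (W : ℝ))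
      (fun n => (hg n).leftContinuous t τ) (.of_forall fun τ' n => (hg n).norm_le hW t τ')
  eVariationOn_le t := by
    have hlim : ∀ τ ∈ (univ : Set (Icc a b)), Tendsto
        (fun n => ∑ i ∈ Finset.range n, g i t τ) atTop (𝓝 (∑' n, g n t τ)) :=
      fun τ _ => (summable hg hW hM t τ).hasSum.tendsto_sum_nat
    refine le_of_forall_lt fun v hv => ?_
    -- Variation is lower semicontinuous under pointwise convergence, so bounds on partial sums
    -- suffice.
    obtain ⟨n, hn⟩ := (eVariationOn.lowerSemicontinuous_aux hlim hv).exists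
    refine hn.trans_le ((eVariationOn_sum_le _ _ _).trans ?_)
    calc ∑ i ∈ Finset.range n, eVariationOn (g i t) univ
        ≤ ∑ i ∈ Finset.range n, M i * w t := Finset.sum_le_sum fun i _ => (hg i).eVariationOn_le t
      _ = ↑(∑ i ∈ Finset.range n, M i) * w t := by rw [ENNReal.ofNNReal_finsetSum, Finset.sum_mul]
      _ ≤ ↑(∑' n, M n) * w t := by
          gcongr
          exact hM.sum_le_tsum _ fun _ _ => zero_le

theorem hasSum_integralOp {g : ℕ → Icc a b → Icc a b → RealMat d} {M : ℕ → ℝ≥0}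
    (hg : ∀ n, IsWeightedKernel w (M n) (g n)) (hW : ∀ t, w t ≤ W) (hM : Summable M)
    (hκ : IsStieltjesVolterraKernel κ) (t β : Icc a b) :
    HasSum (fun n => hκ.integralOp (fun τ => g n τ β) t)
      (hκ.integralOp (fun τ => ∑' n, g n τ β) t) := by
  refine VectorMeasure.hasSum_integral_of_dominated_convergence (fun n _ => (M n * W : ℝ))
    (fun n => ((hg n).stronglyMeasurable_left β).aestronglyMeasurable)
    (fun n => .of_forall fun τ => (hg n).norm_le hW τ β) ?_ ?_ ?_
  · exact .of_forall fun _ => (NNReal.summable_coe.2 hM).mul_right (W : ℝ)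
  · exact integrable_const _
  · exact .of_forall fun τ => (summable hg hW hM τ β).hasSum

/-- A weighted kernel satisfying the resolvent equation is a Stieltjes-Volterra kernel. -/
theorem isStieltjesVolterraKernel (hρ : IsWeightedKernel w M ρ) (hW : ∀ t, w t ≤ W)
    (hκ : IsStieltjesVolterraKernel κ)
    (heq : ∀ t β, ρ t β = -κ t β + hκ.integralOp (fun τ => ρ τ β) t) :
    IsStieltjesVolterraKernel ρ where
  measurable := stronglyMeasurable_matrix_iff.1 hρ.stronglyMeasurable
  eq_zero := hρ.eq_zero
  boundedVariation t := ((hρ.eVariationOn_le t).trans_lt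
    (ENNReal.mul_lt_top ENNReal.coe_lt_top ((hW t).trans_lt ENNReal.coe_lt_top))).ne
  leftContinuous := hρ.leftContinuous
  bounded y₀ := by
    refine ⟨M * W + M * W, fun t => ?_⟩
    have h : (M : ℝ≥0∞) * w t ≤ ↑(M * W) := by
      rw [ENNReal.coe_mul]
      gcongr
      exact hW t
    rw [ENNReal.coe_add]
    exact add_le_add ((hρ.eVariationOn_le t).trans h) ((hρ.enorm_le t y₀).trans h)
  variation_diagonal ε hε := by
    -- With `V` the variation of `κ(t,·)` on `[s,t)`, the term `-κ` contributes `V` and the integral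
    -- at most `MW · 2V`.
    have hK : (0 : ℝ) < 1 + 2 * (M * W) := by positivity
    obtain ⟨η, hη, hdiag⟩ := hκ.variation_diagonal (ε / (1 + 2 * (M * W))) (by positivity)
    refine ⟨η, hη, fun t s hst hstη => ?_⟩
    have hst' : s < t := Subtype.coe_lt_coe.1 (sub_pos.1 hst)
    have hV := hdiag t s hst hstη
    set V := eVariationOn (κ t) (Ico s t)
    -- For `τ < s` the map `ρ(τ,·)` vanishes on `[s,t)`, and `τ ≥ t` is null; only the mass of
    -- `[s,t)` counts.
    have hpt : ∀ᵐ τ ∂(hκ.slice t).variation,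
        eVariationOn (ρ τ) (Ico s t) ≤ (Ico s t).indicator (fun _ => ↑(M * W)) τ := by
      have : (Ici t)ᶜ ∈ ae (hκ.slice t).variation := by
        rw [compl_mem_ae_iff]
        exact hκ.variation_slice_Ici t
      filter_upwards [this] with τ hτ
      rcases lt_or_ge τ s with h | h
      · rw [eVariationOn.eq_of_eqOn (f' := fun _ => 0)
          fun x hx => hρ.eq_zero τ x (h.le.trans hx.1)]
        simp [eVariationOn]
      · rw [indicator_of_mem (show τ ∈ Ico s t from ⟨h, notMem_Ici.1 hτ⟩), ENNReal.coe_mul]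
        grw [eVariationOn.mono (ρ τ) (subset_univ (Ico s t)), hρ.eVariationOn_le τ, hW τ]
    have hint : eVariationOn (fun β => hκ.integralOp (fun τ => ρ τ β) t) (Ico s t)
        ≤ ↑(M * W) * (2 * V) := by
      calc _ ≤ ∫⁻ τ, eVariationOn (ρ τ) (Ico s t) ∂(hκ.slice t).variation :=
            hρ.eVariationOn_integralOp_le hW hκ t _
        _ ≤ ∫⁻ τ, (Ico s t).indicator (fun _ => ↑(M * W)) τ ∂(hκ.slice t).variation :=
            lintegral_mono_ae hpt
        _ = ↑(M * W) * (hκ.slice t).variation (Ico s t) :=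
            lintegral_indicator_const measurableSet_Ico _
        _ ≤ _ := by grw [hκ.variation_slice_Ico_le hst']
    calc eVariationOn (ρ t) (Ico s t)
        = eVariationOn (fun β => -κ t β + hκ.integralOp (fun τ => ρ τ β) t) (Ico s t) :=
          eVariationOn.eq_of_eqOn fun β _ => heq t β
      _ ≤ V + ↑(M * W) * (2 * V) := by
          refine (eVariationOn_add_le _ _ _).trans (add_le_add ?_ hint)
          exact (eVariationOn_fun_neg _ _).le
      _ = ENNReal.ofReal (1 + 2 * (M * W)) * V := by
          rw [ENNReal.ofReal_add (by norm_num) (by positivity),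
            ENNReal.ofReal_mul (by norm_num), ← NNReal.coe_mul, ENNReal.ofReal_coe_nnreal]
          simp only [ENNReal.ofReal_one, ENNReal.ofReal_ofNat]
          ring
      _ < ENNReal.ofReal (1 + 2 * (M * W)) * ENNReal.ofReal (ε / (1 + 2 * (M * W))) :=
          ENNReal.mul_lt_mul_right (by simpa using hK) ENNReal.ofReal_ne_top hV
      _ = ENNReal.ofReal ε := by
          rw [← ENNReal.ofReal_mul hK.le, mul_div_cancel₀ _ hK.ne']

end IsWeightedKernel

/-! ### Existence and uniqueness of the resolvent -/

namespace IsStieltjesVolterraKernel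

theorem isResolvent_iff (hκ : IsStieltjesVolterraKernel κ) :
    IsResolvent κ ρ ↔ IsStieltjesVolterraKernel ρ ∧
      ∀ t β, ρ t β = -κ t β + hκ.integralOp (fun τ => ρ τ β) t := by
  constructor
  · refine fun h => ⟨h.isKernel, fun t β => ?_⟩
    rw [← hκ.stieltjesIntegral_eq_integralOp t β fun τ hτ => h.isKernel.eq_zero τ β hτ]
    exact h.equation t β
  · refine fun h => ⟨h.1, fun t β => ?_⟩
    rw [hκ.stieltjesIntegral_eq_integralOp t β fun τ hτ => h.1.eq_zero τ β hτ]
    exact h.2 t β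

/-- The Neumann series of the resolvent. -/
noncomputable def resolventTerm (hκ : IsStieltjesVolterraKernel κ) :
    ℕ → Icc a b → Icc a b → RealMat d
  | 0 => fun t β => -κ t β
  | n + 1 => fun t β => hκ.integralOp (fun τ => hκ.resolventTerm n τ β) t

theorem exists_isResolvent (hκ : IsStieltjesVolterraKernel κ) : ∃ ρ, IsResolvent κ ρ := by
  obtain ⟨w, W, hw1, hW, hw⟩ := hκ.exists_weight
  obtain ⟨M, hM⟩ := hκ.exists_isWeightedKernel hw1
  have hterm : ∀ n, IsWeightedKernel w (M * 2⁻¹ ^ n) (hκ.resolventTerm n) := fun n => by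
    induction n with
    | zero =>
      rw [pow_zero, mul_one]
      exact hM.neg
    | succ n ih =>
      rw [pow_succ, ← mul_assoc]
      exact ih.integralOp hW hκ hw
  have hsum : Summable fun n : ℕ => M * (2⁻¹ : ℝ≥0) ^ n :=
    (NNReal.summable_geometric (by norm_num [inv_lt_one_iff₀])).mul_left M
  have hρ := IsWeightedKernel.tsum hterm hW hsum
  have heq : ∀ t β, ∑' n, hκ.resolventTerm n t β
      = -κ t β + hκ.integralOp (fun τ => ∑' n, hκ.resolventTerm n τ β) t := fun t β => by
    have h : HasSum (fun n => hκ.resolventTerm (n + 1) t β)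
        (hκ.integralOp (fun τ => ∑' n, hκ.resolventTerm n τ β) t) :=
      IsWeightedKernel.hasSum_integralOp hterm hW hsum hκ t β
    rw [(IsWeightedKernel.summable hterm hW hsum t β).tsum_eq_zero_add, h.tsum_eq]
    rfl
  exact ⟨_, hκ.isResolvent_iff.2 ⟨hρ.isStieltjesVolterraKernel hW hκ heq, heq⟩⟩

/-- As `w ≥ 1`, both resolvents are weighted kernels, so their difference is bounded by a multiple
of `w`; each use of the homogeneous equation halves the multiple. -/
theorem isResolvent_unique (hκ : IsStieltjesVolterraKernel κ)
    {ρ₁ ρ₂ : Icc a b → Icc a b → RealMat d} (h₁ : IsResolvent κ ρ₁) (h₂ : IsResolvent κ ρ₂) :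
    ρ₁ = ρ₂ := by
  obtain ⟨w, W, hw1, hW, hw⟩ := hκ.exists_weight
  obtain ⟨hk₁, heq₁⟩ := hκ.isResolvent_iff.1 h₁
  obtain ⟨hk₂, heq₂⟩ := hκ.isResolvent_iff.1 h₂
  obtain ⟨M₁, hM₁⟩ := hk₁.exists_isWeightedKernel hw1
  obtain ⟨M₂, hM₂⟩ := hk₂.exists_isWeightedKernel hw1
  have hdiff : ∀ t β, ρ₁ t β - ρ₂ t β = hκ.integralOp (fun τ => ρ₁ τ β - ρ₂ τ β) t := fun t β => by
    have : hκ.integralOp (fun τ => ρ₁ τ β - ρ₂ τ β) t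
        = hκ.integralOp (fun τ => ρ₁ τ β) t - hκ.integralOp (fun τ => ρ₂ τ β) t :=
      VectorMeasure.integral_fun_sub (hM₁.integrable hW β _) (hM₂.integrable hW β _)
    rw [this, heq₁ t β, heq₂ t β]
    abel
  have hbound : ∀ (n : ℕ) t β, ‖ρ₁ t β - ρ₂ t β‖ₑ ≤ ↑((M₁ + M₂) * 2⁻¹ ^ n) * w t := fun n => by
    induction n with
    | zero =>
      intro t β
      rw [pow_zero, mul_one, ENNReal.coe_add, add_mul]
      exact enorm_sub_le.trans (add_le_add (hM₁.enorm_le t β) (hM₂.enorm_le t β))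
    | succ n ih =>
      intro t β
      calc ‖ρ₁ t β - ρ₂ t β‖ₑ
          ≤ ∫⁻ τ, ‖ρ₁ τ β - ρ₂ τ β‖ₑ ∂(hκ.slice t).variation := by
            conv_lhs => rw [hdiff t β]
            exact hκ.enorm_integralOp_le _ t
        _ ≤ ∫⁻ τ, ↑((M₁ + M₂) * 2⁻¹ ^ n) * w τ ∂(hκ.slice t).variation :=
            lintegral_mono fun τ => ih τ β
        _ = ↑((M₁ + M₂) * 2⁻¹ ^ n) * ∫⁻ τ, w τ ∂(hκ.slice t).variation :=
            lintegral_const_mul' _ _ ENNReal.coe_ne_top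
        _ ≤ ↑((M₁ + M₂) * 2⁻¹ ^ n) * (w t * 2⁻¹) := by grw [hw t]
        _ = ↑((M₁ + M₂) * 2⁻¹ ^ (n + 1)) * w t := by
            rw [pow_succ, ← mul_assoc (M₁ + M₂), ENNReal.coe_mul _ 2⁻¹, ENNReal.coe_inv (by norm_num),
              ENNReal.coe_ofNat]
            ring
  funext t β
  have hlim : Tendsto (fun n : ℕ => (↑((M₁ + M₂) * 2⁻¹ ^ n * W) : ℝ≥0∞)) atTop (𝓝 0) := by
    rw [← ENNReal.coe_zero, ENNReal.tendsto_coe]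
    have h := ((tendsto_pow_atTop_nhds_zero_of_lt_one (r := (2⁻¹ : ℝ≥0)) zero_le
      (by norm_num [inv_lt_one_iff₀])).const_mul (M₁ + M₂)).mul_const W
    simpa using h
  have hzero : ‖ρ₁ t β - ρ₂ t β‖ₑ ≤ 0 := ge_of_tendsto' hlim fun n => by
    rw [ENNReal.coe_mul]
    exact (hbound n t β).trans (mul_le_mul_right (hW t) _)
  exact sub_eq_zero.1 (enorm_eq_zero.1 (nonpos_iff_eq_zero.1 hzero))

end IsStieltjesVolterraKernel

theorem lemma1 {d : ℕ} {a b : ℝ} (κ : Set.Icc a b → Set.Icc a b → RealMat d)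
    (hκ : IsStieltjesVolterraKernel κ) :
    ∃! ρ : Set.Icc a b → Set.Icc a b → RealMat d, IsResolvent κ ρ := by
  obtain ⟨ρ, hρ⟩ := hκ.exists_isResolvent
  exact ⟨ρ, hρ, fun σ hσ => hκ.isResolvent_unique hσ hρ⟩
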